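/- Let $X\in\mathbb R^n$ be a random vector with an arbitrary law $P_X$, and let $Z\in\mathbb R^k$ be a random vector with a Lipschitz continuous probability density $q_Z$ such that $q_Z(z)>0$ for all $z\in\mathbb R^k$. Let $\sigma_{\mathrm g}\colon\mathbb R\to\mathbb R$ be bounded and continuous with $\lim_{r\to-\infty}\sigma_{\mathrm g}(r)<\lim_{r\to+\infty}\sigma_{\mathrm g}(r)$ (both limits exist). For $\kappa=(\kappa_w,\kappa_b)\in\mathbb R^{n\times k}\times\mathbb R^n$ put $\phi(z;\kappa)=\sigma_{\mathrm g}(\kappa_w z+\kappa_b)$ (componentwise), let $\mathcal M$ be the space of finite signed Borel measures on $\mathbb R^{n\times k}\times\mathbb R^n$, and for $\theta\in\mathcal M$ let $g_\theta(z)=\int\phi(z;\kappa)\,d\theta(\kappa)$ for $z\in\mathbb R^k$. Let $\sigma\colon\mathbb R\to\mathbb R$ be the sigmoid $r\mapsto 1/(1+e^{-r})$ or $\tanh$, let $N_d$ be any natural number ($N_d>n$ is allowed), and let $(a_1,b_1),\dots,(a_{N_d},b_{N_d})$ be i.i.d. random elements of $\mathbb R^n\times\mathbb R$ whose common law is absolutely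 continuous with respect to Lebesgue measure. Let $\psi_j(x)=\sigma(a_j^\intercal x+b_j)$, $f_\eta(x)=\sum_{j=1}^{N_d}\eta_j\psi_j(x)$ for $\eta\in\mathbb R^{N_d}$, $$L(\theta,\eta)=\mathbb E_X[f_\eta(X)]-\mathbb E_Z[f_\eta(g_\theta(Z))]-\tfrac12\|\eta\|_2^2,\qquad J(\theta)=\sup_{\eta\in\mathbb R^{N_d}}L(\theta,\eta).$$ Call $\theta_{\mathrm s}\in\mathcal M$ a stationary point of $J$ if for every $\mu\in\mathcal M$ the function $\lambda\mapsto J(\theta_{\mathrm s}+\lambda\mu)$ on $\mathbb R$ is differentiable at $\lambda=0$ with derivative $0$. Then, with probability $1$ with respect to the random choice of $(a_j,b_j)_{j\le N_d}$, the following holds: for every stationary point $\theta_{\mathrm s}$ of $J$, if the range $g_{\theta_{\mathrm s}}(\mathbb R^k)$ contains an open ball of $\mathbb R^n$ (of positive radius), then $J(\theta_{\mathrm s})=0$. -/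

import Mathlib

open MeasureTheory ProbabilityTheory Filter Topology

namespace RandomFeatureGAN

/-- Euclidean space `ℝᵐ`. -/
abbrev E (m : ℕ) : Type := EuclideanSpace ℝ (Fin m)

/-- Parameters `κ = (κ_w, κ_b) ∈ ℝ^{n × k} × ℝⁿ` of a generator feature function
`ℝᵏ → ℝⁿ`. -/
abbrev GenParam (k n : ℕ) : Type := (Fin n → Fin k → ℝ) × (Fin n → ℝ)

/-- The assumption on the latent distribution: it has a Lipschitz continuous and everywhere
positive probability density on `ℝᵏ` with respect to Lebesgue measure. -/
structure IsLatentLaw {k : ℕ} (PZ : Measure (E k)) : Prop where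
  isProbability : IsProbabilityMeasure PZ
  density : ∃ q : E k → ℝ, (∃ K : NNReal, LipschitzWith K q) ∧ (∀ z, 0 < q z) ∧
    PZ = volume.withDensity (fun z => ENNReal.ofReal (q z))

/-- The assumption on the generator activation function: bounded, continuous, with
limits at `-∞` and at `+∞`, the first one smaller than the second one. -/
structure IsGeneratorActivation (σg : ℝ → ℝ) : Prop where
  continuous : Continuous σg
  bounded : ∃ C : ℝ, ∀ r, |σg r| ≤ C
  limits : ∃ l u : ℝ, Tendsto σg atBot (𝓝 l) ∧ Tendsto σg atTop (𝓝 u) ∧ l < u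

/-- The random generation of the discriminator weights: the pairs `(a_j, b_j)`
are independent, with a common law on `ℝⁿ × ℝ` that is absolutely continuous with respect to
Lebesgue measure. -/
structure IsRandomWeights {Ω : Type*} [MeasurableSpace Ω] (P : Measure Ω) {n N : ℕ}
    (a : Fin N → Ω → E n) (b : Fin N → Ω → ℝ) : Prop where
  indep : iIndepFun (fun j ω => (a j ω, b j ω)) P
  law : ∃ ν : Measure (E n × ℝ), ν ≪ volume ∧ ∀ j, HasLaw (fun ω => (a j ω, b j ω)) ν P

noncomputable section

/-- The generator feature function `φ(z; κ) = σ_g(κ_w z + κ_b)`, with `σ_g` applied to each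
coordinate. -/
def phi {k n : ℕ} (σg : ℝ → ℝ) (z : E k) (κ : GenParam k n) : E n :=
  WithLp.toLp 2 fun i => σg ((Matrix.of κ.1).mulVec z.ofLp i + κ.2 i)

/-- The infinite-width generator `g_θ(z) = ∫ φ(z; κ) dθ(κ)`, for a finite signed measure `θ` on
the parameter space. -/
def gen {k n : ℕ} (σg : ℝ → ℝ) (θ : SignedMeasure (GenParam k n)) (z : E k) : E n :=
  ∫ᵛ κ, phi σg z κ ∂<•θ

/-- The discriminator feature functions `ψ_j(x) = σ(a_jᵀ x + b_j)`. -/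
def psi {n N : ℕ} (σ : ℝ → ℝ) (a : Fin N → E n) (b : Fin N → ℝ) (j : Fin N) (x : E n) : ℝ :=
  σ (inner ℝ (a j) x + b j)

/-- The discriminator `f_η(x) = ∑ⱼ η_j ψ_j(x)`. -/
def disc {n N : ℕ} (σ : ℝ → ℝ) (a : Fin N → E n) (b : Fin N → ℝ) (η : E N) (x : E n) : ℝ :=
  ∑ j, η j * psi σ a b j x

/-- The loss `L(θ, η) = 𝔼[f_η(X)] - 𝔼[f_η(g_θ(Z))] - ‖η‖² / 2`. -/
def loss {k n N : ℕ} (PX : Measure (E n)) (PZ : Measure (E k)) (σg σ : ℝ → ℝ)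
    (a : Fin N → E n) (b : Fin N → ℝ) (θ : SignedMeasure (GenParam k n)) (η : E N) : ℝ :=
  (∫ x, disc σ a b η x ∂PX) - (∫ z, disc σ a b η (gen σg θ z) ∂PZ) - 1 / 2 * ‖η‖ ^ 2

/-- The objective `J(θ) = sup_η L(θ, η)`. For a bounded continuous `σ` it is the
supremum of a concave quadratic function that is bounded above. -/
def J {k n N : ℕ} (PX : Measure (E n)) (PZ : Measure (E k)) (σg σ : ℝ → ℝ)
    (a : Fin N → E n) (b : Fin N → ℝ) (θ : SignedMeasure (GenParam k n)) : ℝ :=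
  ⨆ η : E N, loss PX PZ σg σ a b θ η

/-- `θ` is a stationary point of `J`: for every finite signed measure `μ`, the function
`t ↦ J(θ + t μ)` of the real variable `t` is differentiable at `0` with derivative `0`. -/
def IsStationary {k n N : ℕ} (PX : Measure (E n)) (PZ : Measure (E k)) (σg σ : ℝ → ℝ)
    (a : Fin N → E n) (b : Fin N → ℝ) (θ : SignedMeasure (GenParam k n)) : Prop :=
  ∀ μ : SignedMeasure (GenParam k n),
    HasDerivAt (fun t : ℝ => J PX PZ σg σ a b (θ + t • μ)) 0 0

end

end RandomFeatureGAN

/-!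
The argument is deterministic: it works for every value of the discriminator weights `(a_j, b_j)`.

Let `v ∈ ℝᴺ` be the vector of the gaps `v_j = 𝔼[ψ_j(X)] - 𝔼[ψ_j(g_θ(Z))]`. The loss is
`⟪η, v⟫ - ‖η‖² / 2`, so the supremum is attained at `η = v` and `J(θ) = ‖v‖² / 2` (`J_eq`).
Differentiating this along `θ + t μ` under the integral sign, stationarity reads
`𝔼⟪D(Z), g_μ(Z)⟫ = 0` for every `μ`, where `D(z) = ∇f_v(g_θ(z))`. For Dirac masses `μ` it says that
each coordinate `D_i` satisfies `𝔼[D_i(Z) σ_g(⟪w, Z⟫ + β)] = const` for all `w` and `β`.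

A function with this property vanishes almost everywhere: blowing up the parameters, `σ_g`
turns into a two-valued step function of a half-space, so the integrals of `D_i` over all half-spaces
vanish (`setIntegral_halfSpace_eq_zero`). Hence the positive and the negative part of `D_i · P_Z`
have the same image under every linear form, and they agree because their characteristic functions do
(`ae_eq_zero_of_setIntegral_halfSpace_eq_zero`). As `D` is continuous and the latent density is
positive everywhere, `∇f_v` vanishes on the whole range of `g_θ`
(`IsStationary.discGrad_eq_zero`), in particular on an open ball.

But `f_v` is real analytic, so it is then constant on `ℝⁿ`, and
`‖v‖² = ⟪v, v⟫ = 𝔼[f_v(X)] - 𝔼[f_v(g_θ(Z))] = 0`. No linear independence of the features `ψ_j` is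
needed, which is why `N > n` and degenerate weights do no harm.
-/

namespace RandomFeatureGAN

/-! ### Discriminator activations -/

lemma tanh_eq_sigmoid (x : ℝ) : Real.tanh x = 2 * Real.sigmoid (2 * x) - 1 := by
  rw [Real.tanh_eq, Real.sigmoid_def]
  have h : Real.exp (-(2 * x)) = Real.exp (-x) / Real.exp x := by
    rw [← Real.exp_sub]; congr 1; ring
  have h1 := Real.exp_pos x
  have h2 := Real.exp_pos (-x)
  rw [h]
  field_simp
  ring

/-- The properties of a discriminator activation that the argument uses; the sigmoid and `tanh` both
have them. -/
structure IsDiscriminatorActivation (σ : ℝ → ℝ) : Prop where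
  analytic : AnalyticOnNhd ℝ σ Set.univ
  bounded : ∃ C : ℝ, ∀ r, |σ r| ≤ C
  bounded_deriv : ∃ C : ℝ, ∀ r, |deriv σ r| ≤ C

lemma isDiscriminatorActivation_sigmoid : IsDiscriminatorActivation Real.sigmoid where
  analytic := analyticOnNhd_sigmoid
  bounded := ⟨1, fun r => abs_le.2
    ⟨by linarith [Real.sigmoid_pos r], (Real.sigmoid_lt_one r).le⟩⟩
  bounded_deriv := ⟨1, fun r => by
    have h0 := Real.sigmoid_pos r
    have h1 := Real.sigmoid_lt_one r
    rw [Real.deriv_sigmoid, abs_le]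
    constructor <;> nlinarith⟩

lemma isDiscriminatorActivation_tanh : IsDiscriminatorActivation Real.tanh := by
  have h : Real.tanh = fun x => 2 * Real.sigmoid (2 * x) - 1 := funext tanh_eq_sigmoid
  refine ⟨?_, ⟨1, fun r => (Real.abs_tanh_lt_one r).le⟩, ?_⟩
  · intro x _
    rw [h]
    exact (analyticAt_const.mul (analyticAt_const.mul analyticAt_id).sigmoid').sub analyticAt_const
  · obtain ⟨C, hC⟩ := isDiscriminatorActivation_sigmoid.bounded_deriv
    refine ⟨4 * C, fun r => ?_⟩
    have hd : HasDerivAt Real.tanh (2 * (deriv Real.sigmoid (2 * r) * (2 * 1)) - 0) r := by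
      rw [h]
      exact (((differentiable_sigmoid (2 * r)).hasDerivAt.comp r
        ((hasDerivAt_id r).const_mul 2)).const_mul 2).sub (hasDerivAt_const r 1)
    rw [hd.deriv]
    have := hC (2 * r)
    rw [abs_le] at this ⊢
    constructor <;> linarith

namespace IsDiscriminatorActivation

variable {σ : ℝ → ℝ}

lemma differentiable (hσ : IsDiscriminatorActivation σ) : Differentiable ℝ σ :=
  fun x => (hσ.analytic x trivial).differentiableAt

lemma continuous_deriv (hσ : IsDiscriminatorActivation σ) : Continuous (deriv σ) :=
  continuous_iff_continuousAt.2 fun x => (hσ.analytic.deriv x trivial).continuousAt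

end IsDiscriminatorActivation

/-! ### The generator -/

lemma phi_eq {k n : ℕ} (σg : ℝ → ℝ) (z : E k) (κ : GenParam k n) :
    phi σg z κ = WithLp.toLp 2 fun i => σg (∑ j, κ.1 i j * z j + κ.2 i) := rfl

lemma continuous_phi {k n : ℕ} {σg : ℝ → ℝ} (hσg : Continuous σg) :
    Continuous fun p : E k × GenParam k n => phi σg p.1 p.2 := by
  simp only [phi_eq]
  fun_prop

lemma exists_norm_phi_le {σg : ℝ → ℝ} (hσg : ∃ C : ℝ, ∀ r, |σg r| ≤ C) (k n : ℕ) :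
    ∃ C : ℝ, ∀ (z : E k) (κ : GenParam k n), ‖phi σg z κ‖ ≤ C := by
  obtain ⟨C, hC⟩ := hσg
  refine ⟨√(∑ _i : Fin n, C ^ 2), fun z κ => ?_⟩
  rw [EuclideanSpace.norm_eq]
  refine Real.sqrt_le_sqrt (Finset.sum_le_sum fun i _ => ?_)
  exact pow_le_pow_left₀ (norm_nonneg _) (hC _) 2

instance {X : Type*} [MeasurableSpace X] (μ : SignedMeasure X) :
    IsFiniteMeasure μ.variation := by
  rw [← SignedMeasure.totalVariation_eq_variation, SignedMeasure.totalVariation]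
  infer_instance

section Generator

variable {k n : ℕ} {σg : ℝ → ℝ}

lemma integrable_phi (hσg : IsGeneratorActivation σg) (μ : SignedMeasure (GenParam k n))
    (z : E k) : μ.Integrable (phi σg z) := by
  obtain ⟨C, hC⟩ := exists_norm_phi_le hσg.bounded k n
  have hc : Continuous (phi (n := n) σg z) :=
    (continuous_phi hσg.continuous).comp (by fun_prop : Continuous fun κ => (z, κ))
  exact MeasureTheory.Integrable.of_bound hc.aestronglyMeasurable C (ae_of_all _ (hC z))

lemma gen_add_smul (hσg : IsGeneratorActivation σg) (θ μ : SignedMeasure (GenParam k n)) (t : ℝ)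
    (z : E k) : gen σg (θ + t • μ) z = gen σg θ z + t • gen σg μ z := by
  rw [gen, VectorMeasure.integral_add_vectorMeasure (integrable_phi hσg θ z)
    ((integrable_phi hσg μ z).smul_vectorMeasure t), VectorMeasure.integral_smul_vectorMeasure]
  rfl

/-- A generator feature function is itself the generator of a Dirac mass. -/
lemma gen_dirac (κ : GenParam k n) (z : E k) :
    gen σg (VectorMeasure.dirac κ (1 : ℝ)) z = phi σg z κ := by
  rw [gen, VectorMeasure.integral_dirac]
  simp

lemma continuous_gen (hσg : IsGeneratorActivation σg) (μ : SignedMeasure (GenParam k n)) :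
    Continuous (gen σg μ) := by
  obtain ⟨C, hC⟩ := exists_norm_phi_le hσg.bounded k n
  refine VectorMeasure.continuous_of_dominated (bound := fun _ => C)
    (fun z => (integrable_phi hσg μ z).aestronglyMeasurable) (fun z => ae_of_all _ (hC z))
    (integrable_const C) (ae_of_all _ fun κ => ?_)
  exact (continuous_phi hσg.continuous).comp (by fun_prop : Continuous fun z => (z, κ))

lemma exists_norm_gen_le (hσg : IsGeneratorActivation σg) (μ : SignedMeasure (GenParam k n)) :
    ∃ C : ℝ, ∀ z, ‖gen σg μ z‖ ≤ C := by
  obtain ⟨C, hC⟩ := exists_norm_phi_le hσg.bounded k n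
  exact ⟨_, fun z => VectorMeasure.norm_integral_le_of_norm_le_const (ae_of_all _ (hC z))⟩

end Generator

/-! ### Functions with vanishing half-space integrals -/

section HalfSpace

/-- The dilation `x ↦ p² x + p` turns `g` into a step function in the limit. The shift `p` grows more
slowly than `p²`, but it settles the value on the boundary `x = 0`, so that no assumption on
the measure of hyperplanes is needed later. -/
lemma tendsto_comp_sq_mul_add {g : ℝ → ℝ} {l u : ℝ} (hl : Tendsto g atBot (𝓝 l))
    (hu : Tendsto g atTop (𝓝 u)) (x : ℝ) :
    Tendsto (fun p : ℝ => g (p * (p * x + 1))) atTop (𝓝 (if 0 ≤ x then u else l)) := by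
  rcases lt_trichotomy x 0 with hx | rfl | hx
  · rw [if_neg hx.not_ge]
    exact hl.comp (tendsto_id.atTop_mul_atBot₀
      (tendsto_atBot_add_const_right _ 1 (tendsto_id.atTop_mul_const_of_neg hx)))
  · simpa using hu
  · rw [if_pos hx.le]
    exact hu.comp (tendsto_id.atTop_mul_atTop₀
      (tendsto_atTop_add_const_right _ 1 (tendsto_id.atTop_mul_const hx)))

/-- If the integral of `h` against every ridge function `z ↦ g (L z + b)` is the same constant, then
the integral of `h` over every half-space vanishes. -/
lemma setIntegral_halfSpace_eq_zero {F : Type*} [NormedAddCommGroup F] [NormedSpace ℝ F]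
    [MeasurableSpace F] [BorelSpace F] {μ : Measure F} {g : ℝ → ℝ} (hg : IsGeneratorActivation g)
    {h : F → ℝ} (hh : Integrable h μ) {c : ℝ}
    (hc : ∀ (L : StrongDual ℝ F) (b : ℝ), ∫ z, h z * g (L z + b) ∂μ = c)
    (L : StrongDual ℝ F) (s : ℝ) :
    ∫ z in {z | s ≤ L z}, h z ∂μ = 0 := by
  obtain ⟨l, u, hl, hu, hlu⟩ := hg.limits
  obtain ⟨C, hC⟩ := hg.bounded
  -- The linear form `L = 0` gives `(∫ h) g(b) = c` for all `b`; let `b → ±∞`.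
  have h0 : ∀ b, (∫ z, h z ∂μ) * g b = c := fun b => by
    simpa [integral_mul_const] using hc 0 b
  have hcl : (∫ z, h z ∂μ) * l = c := tendsto_nhds_unique (hl.const_mul _)
    (tendsto_const_nhds.congr fun b => (h0 b).symm)
  have hcu : (∫ z, h z ∂μ) * u = c := tendsto_nhds_unique (hu.const_mul _)
    (tendsto_const_nhds.congr fun b => (h0 b).symm)
  have hs : MeasurableSet {z | s ≤ L z} := measurableSet_le measurable_const L.continuous.measurable
  have key : Tendsto (fun p : ℝ => ∫ z, h z * g (p * (p * (L z - s) + 1)) ∂μ) atTop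
      (𝓝 (∫ z, h z * (if 0 ≤ L z - s then u else l) ∂μ)) := by
    refine tendsto_integral_filter_of_dominated_convergence (fun z => ‖h z‖ * C) ?_ ?_
      (hh.norm.mul_const C) ?_
    · refine Eventually.of_forall fun p => hh.aestronglyMeasurable.mul ?_
      have := hg.continuous
      exact Measurable.aestronglyMeasurable (by fun_prop)
    · refine Eventually.of_forall fun p => ae_of_all _ fun z => ?_
      rw [norm_mul]
      exact mul_le_mul_of_nonneg_left (hC _) (norm_nonneg _)
    · exact ae_of_all _ fun z => (tendsto_comp_sq_mul_add hl hu _).const_mul _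
  have hlim : ∫ z, h z * (if 0 ≤ L z - s then u else l) ∂μ = c := by
    refine tendsto_nhds_unique key (tendsto_const_nhds.congr fun p => ?_)
    rw [← hc ((p * p) • L) (p - p * p * s)]
    congr 1 with z
    simp only [smul_apply, smul_eq_mul]
    ring_nf
  have hsplit : ∀ z, h z * (if 0 ≤ L z - s then u else l) =
      h z * l + {z | s ≤ L z}.indicator h z * (u - l) := fun z => by
    by_cases hz : s ≤ L z
    · simp [hz]; ring
    · simp [hz]
  simp_rw [hsplit] at hlim
  rw [integral_add (hh.mul_const l) ((hh.indicator hs).mul_const _), integral_mul_const,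
    integral_mul_const, integral_indicator hs, hcl] at hlim
  have : (∫ z in {z | s ≤ L z}, h z ∂μ) * (u - l) = 0 := by linarith
  exact (mul_eq_zero.1 this).resolve_right (sub_pos.2 hlu).ne'

/-- The integrals of an integrable function over all half-spaces determine it almost everywhere. -/
lemma ae_eq_zero_of_setIntegral_halfSpace_eq_zero {F : Type*} [NormedAddCommGroup F]
    [NormedSpace ℝ F] [CompleteSpace F] [SecondCountableTopology F] [MeasurableSpace F]
    [BorelSpace F] {μ : Measure F} [IsFiniteMeasure μ] {h : F → ℝ} (hh : Integrable h μ)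
    (hL : ∀ (L : StrongDual ℝ F) (s : ℝ), ∫ z in {z | s ≤ L z}, h z ∂μ = 0) :
    h =ᵐ[μ] 0 := by
  have hfin : IsFiniteMeasure (μ.withDensity fun z => ENNReal.ofReal (h z)) :=
    isFiniteMeasure_withDensity_ofReal hh.2
  have hfin' : IsFiniteMeasure (μ.withDensity fun z => ENNReal.ofReal (-h z)) :=
    isFiniteMeasure_withDensity_ofReal hh.neg.2
  -- The positive and the negative part of `h • μ` have the same image under each linear form,
  -- hence the same characteristic function.
  have heq : (μ.withDensity fun z => ENNReal.ofReal (h z)) =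
      μ.withDensity fun z => ENNReal.ofReal (-h z) := by
    refine Measure.ext_of_charFunDual (funext fun L => ?_)
    rw [charFunDual_eq_charFun_map_one, charFunDual_eq_charFun_map_one]
    congr 1
    refine Measure.ext_of_Ici _ _ fun s => ?_
    have hs : MeasurableSet (L ⁻¹' Set.Ici s) := L.continuous.measurable measurableSet_Ici
    rw [Measure.map_apply L.continuous.measurable measurableSet_Ici,
      Measure.map_apply L.continuous.measurable measurableSet_Ici,
      withDensity_apply _ hs, withDensity_apply _ hs]
    have h0 := hL L s
    rw [integral_eq_lintegral_pos_part_sub_lintegral_neg_part hh.integrableOn, sub_eq_zero] at h0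
    refine (ENNReal.toReal_eq_toReal_iff' ?_ ?_).1 h0
    · exact (hh.integrableOn.lintegral_lt_top).ne
    · exact (hh.neg.integrableOn.lintegral_lt_top).ne
  have hae := (withDensity_eq_iff hh.aestronglyMeasurable.aemeasurable.ennreal_ofReal
    hh.neg.aestronglyMeasurable.aemeasurable.ennreal_ofReal hh.lintegral_lt_top.ne).1 heq
  filter_upwards [hae] with z hz
  rcases le_total 0 (h z) with h0 | h0
  · have : ENNReal.ofReal (h z) = 0 := by
      rw [hz]; exact ENNReal.ofReal_of_nonpos (by simpa using h0)
    exact le_antisymm (ENNReal.ofReal_eq_zero.1 this) h0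
  · have : ENNReal.ofReal (-h z) = 0 := by
      rw [← Pi.neg_apply h z]; exact hz.symm.trans (ENNReal.ofReal_of_nonpos h0)
    exact le_antisymm h0 (by simpa using ENNReal.ofReal_eq_zero.1 this)

end HalfSpace

/-! ### The discriminator -/

section Discriminator

variable {n N : ℕ} {σ : ℝ → ℝ}

lemma continuous_psi (hσ : IsDiscriminatorActivation σ) (a : Fin N → E n) (b : Fin N → ℝ)
    (j : Fin N) : Continuous (psi σ a b j) := by
  have := hσ.differentiable.continuous
  unfold psi
  fun_prop

lemma integrable_psi_comp (hσ : IsDiscriminatorActivation σ) (a : Fin N → E n) (b : Fin N → ℝ)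
    (j : Fin N) {X : Type*} [TopologicalSpace X] [MeasurableSpace X] [OpensMeasurableSpace X]
    (μ : Measure X) [IsFiniteMeasure μ] {f : X → E n} (hf : Continuous f) :
    Integrable (fun x => psi σ a b j (f x)) μ := by
  obtain ⟨C, hC⟩ := hσ.bounded
  exact Integrable.of_bound ((continuous_psi hσ a b j).comp hf).measurable.aestronglyMeasurable C
    (ae_of_all _ fun x => hC _)

lemma integral_disc_comp (hσ : IsDiscriminatorActivation σ) (a : Fin N → E n) (b : Fin N → ℝ)
    (η : E N) {X : Type*} [TopologicalSpace X] [MeasurableSpace X] [OpensMeasurableSpace X]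
    (μ : Measure X) [IsFiniteMeasure μ] {f : X → E n} (hf : Continuous f) :
    ∫ x, disc σ a b η (f x) ∂μ = ∑ j, η j * ∫ x, psi σ a b j (f x) ∂μ := by
  simp only [disc]
  rw [integral_finsetSum _ fun j _ => (integrable_psi_comp hσ a b j μ hf).const_mul _]
  simp only [integral_const_mul]

/-- The gradient `∑ⱼ η_j σ'(a_jᵀ x + b_j) a_j` of the discriminator `f_η` at `x`. -/
noncomputable def discGrad (σ : ℝ → ℝ) (a : Fin N → E n) (b : Fin N → ℝ) (η : E N) (x : E n) :
    E n :=
  ∑ j, (η j * deriv σ (inner ℝ (a j) x + b j)) • a j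

lemma continuous_discGrad (hσ : IsDiscriminatorActivation σ) (a : Fin N → E n) (b : Fin N → ℝ)
    (η : E N) : Continuous (discGrad σ a b η) := by
  have := hσ.continuous_deriv
  unfold discGrad
  fun_prop

lemma exists_norm_discGrad_le (hσ : IsDiscriminatorActivation σ) (a : Fin N → E n)
    (b : Fin N → ℝ) (η : E N) : ∃ C : ℝ, ∀ x, ‖discGrad σ a b η x‖ ≤ C := by
  obtain ⟨C, hC⟩ := hσ.bounded_deriv
  refine ⟨∑ j, ‖η j‖ * C * ‖a j‖, fun x => norm_sum_le_of_le _ fun j _ => ?_⟩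
  rw [norm_smul, norm_mul]
  have := hC (inner ℝ (a j) x + b j)
  gcongr
  exact this

lemma hasFDerivAt_disc (hσ : IsDiscriminatorActivation σ) (a : Fin N → E n) (b : Fin N → ℝ)
    (η : E N) (x : E n) :
    HasFDerivAt (disc σ a b η) (innerSL ℝ (discGrad σ a b η x)) x := by
  have h : ∀ j, HasFDerivAt (fun x => η j * psi σ a b j x)
      (η j • deriv σ (inner ℝ (a j) x + b j) • innerSL ℝ (a j)) x := fun j =>
    (((hσ.differentiable _).hasDerivAt.comp_hasFDerivAt x
      ((innerSL ℝ (a j)).hasFDerivAt.add_const (b j))).const_mul (η j))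
  refine (HasFDerivAt.fun_sum fun j _ => h j).congr_fderiv ?_
  simp [discGrad, map_sum, mul_smul]

lemma analyticOnNhd_disc (hσ : IsDiscriminatorActivation σ) (a : Fin N → E n) (b : Fin N → ℝ)
    (η : E N) : AnalyticOnNhd ℝ (disc σ a b η) Set.univ := by
  intro x _
  refine Finset.analyticAt_fun_sum _ fun j _ => analyticAt_const.mul ?_
  exact (hσ.analytic _ trivial).comp_of_eq
    (((innerSL ℝ (a j)).analyticAt x).add analyticAt_const) rfl

lemma disc_eq_const_of_fderiv_eq_zero_on_ball (hσ : IsDiscriminatorActivation σ)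
    (a : Fin N → E n) (b : Fin N → ℝ) (η : E N) {c : E n} {ε : ℝ} (hε : 0 < ε)
    (h : ∀ x ∈ Metric.ball c ε, fderiv ℝ (disc σ a b η) x = 0) (x : E n) :
    disc σ a b η x = disc σ a b η c := by
  have hball : ∀ y ∈ Metric.ball c ε, disc σ a b η y = disc σ a b η c := fun y hy =>
    Metric.isOpen_ball.is_const_of_fderiv_eq_zero (convex_ball c ε).isPreconnected
      (fun z _ => (hasFDerivAt_disc hσ a b η z).differentiableAt.differentiableWithinAt)
      h hy (Metric.mem_ball_self hε)
  exact congrFun ((analyticOnNhd_disc hσ a b η).eq_of_eventuallyEq (z₀ := c) analyticOnNhd_const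
    (Filter.eventuallyEq_of_mem (Metric.ball_mem_nhds c hε) hball)) x

end Discriminator

/-! ### The objective and its stationary points -/

section Objective

variable {k n N : ℕ} {σg σ : ℝ → ℝ}

/-- The vector of the gaps `𝔼[ψ_j(X)] - 𝔼[ψ_j(g_θ(Z))]`, which is the maximizer of the loss
in `η`. -/
noncomputable def featureGap (PX : Measure (E n)) (PZ : Measure (E k)) (σg σ : ℝ → ℝ)
    (a : Fin N → E n) (b : Fin N → ℝ) (θ : SignedMeasure (GenParam k n)) : E N :=
  WithLp.toLp 2 fun j => ∫ x, psi σ a b j x ∂PX - ∫ z, psi σ a b j (gen σg θ z) ∂PZ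

lemma integral_disc_sub_integral_disc_gen (PX : Measure (E n)) [IsProbabilityMeasure PX]
    (PZ : Measure (E k)) [IsProbabilityMeasure PZ] (hσg : IsGeneratorActivation σg)
    (hσ : IsDiscriminatorActivation σ) (a : Fin N → E n) (b : Fin N → ℝ)
    (θ : SignedMeasure (GenParam k n)) (η : E N) :
    ∫ x, disc σ a b η x ∂PX - ∫ z, disc σ a b η (gen σg θ z) ∂PZ =
      inner ℝ η (featureGap PX PZ σg σ a b θ) := by
  rw [integral_disc_comp hσ a b η PX continuous_id',
    integral_disc_comp hσ a b η PZ (continuous_gen hσg θ), ← Finset.sum_sub_distrib,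
    PiLp.inner_apply]
  refine Finset.sum_congr rfl fun j _ => ?_
  simp [featureGap]
  ring

/-- Completing the square, `L(θ, η) = ‖v‖² / 2 - ‖η - v‖² / 2` for the vector `v` of feature gaps. -/
lemma J_eq (PX : Measure (E n)) [IsProbabilityMeasure PX]
    (PZ : Measure (E k)) [IsProbabilityMeasure PZ] (hσg : IsGeneratorActivation σg)
    (hσ : IsDiscriminatorActivation σ) (a : Fin N → E n) (b : Fin N → ℝ)
    (θ : SignedMeasure (GenParam k n)) :
    J PX PZ σg σ a b θ = 1 / 2 * ‖featureGap PX PZ σg σ a b θ‖ ^ 2 := by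
  set v := featureGap PX PZ σg σ a b θ with hv
  have hloss : ∀ η : E N, loss PX PZ σg σ a b θ η = 1 / 2 * ‖v‖ ^ 2 - 1 / 2 * ‖η - v‖ ^ 2 := by
    intro η
    rw [loss, integral_disc_sub_integral_disc_gen PX PZ hσg hσ, ← hv, norm_sub_sq_real]
    ring
  have hle : ∀ η : E N, loss PX PZ σg σ a b θ η ≤ 1 / 2 * ‖v‖ ^ 2 := fun η => by
    rw [hloss]
    linarith [sq_nonneg ‖η - v‖]
  refine le_antisymm (ciSup_le hle) ?_
  refine le_ciSup_of_le ⟨_, Set.forall_mem_range.2 hle⟩ v ?_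
  simp [hloss]

/-- Differentiation under the integral sign; it is licit because `σ'` and the generator of `μ` are
bounded. -/
lemma hasDerivAt_integral_psi_gen (PZ : Measure (E k)) [IsProbabilityMeasure PZ]
    (hσg : IsGeneratorActivation σg) (hσ : IsDiscriminatorActivation σ) (a : Fin N → E n)
    (b : Fin N → ℝ) (θ μ : SignedMeasure (GenParam k n)) (j : Fin N) :
    Integrable
      (fun z => deriv σ (inner ℝ (a j) (gen σg θ z) + b j) * inner ℝ (a j) (gen σg μ z)) PZ ∧
    HasDerivAt (fun t : ℝ => ∫ z, psi σ a b j (gen σg (θ + t • μ) z) ∂PZ)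
      (∫ z, deriv σ (inner ℝ (a j) (gen σg θ z) + b j) * inner ℝ (a j) (gen σg μ z) ∂PZ) 0 := by
  obtain ⟨C, hC⟩ := hσ.bounded_deriv
  obtain ⟨M, hM⟩ := exists_norm_gen_le hσg μ
  have hgθ := continuous_gen hσg θ
  have hgμ := continuous_gen hσg μ
  have hσ' := hσ.continuous_deriv
  have hC0 : 0 ≤ C := (abs_nonneg _).trans (hC 0)
  simp_rw [gen_add_smul hσg]
  have key := hasDerivAt_integral_of_dominated_loc_of_deriv_le (μ := PZ) (x₀ := (0 : ℝ))
    (s := Set.univ) (bound := fun _ => C * (‖a j‖ * M))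
    (F := fun t z => psi σ a b j (gen σg θ z + t • gen σg μ z))
    (F' := fun t z => deriv σ (inner ℝ (a j) (gen σg θ z + t • gen σg μ z) + b j) *
      inner ℝ (a j) (gen σg μ z)) Filter.univ_mem ?_ ?_ ?_ ?_ (integrable_const _) ?_
  · simpa using key
  · exact Eventually.of_forall fun t =>
      (integrable_psi_comp hσ a b j PZ (by fun_prop)).aestronglyMeasurable
  · exact integrable_psi_comp hσ a b j PZ (by fun_prop)
  · exact Continuous.aestronglyMeasurable (by fun_prop)
  · refine ae_of_all _ fun z t _ => ?_
    rw [norm_mul]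
    exact mul_le_mul (hC _) ((norm_inner_le_norm _ _).trans
      (mul_le_mul_of_nonneg_left (hM z) (norm_nonneg _))) (norm_nonneg _) hC0
  · refine ae_of_all _ fun z t _ => ?_
    have h1 : HasDerivAt (fun t : ℝ => inner ℝ (a j) (gen σg θ z + t • gen σg μ z) + b j)
        (inner ℝ (a j) (gen σg μ z)) t := by
      simp_rw [inner_add_right, inner_smul_right]
      simpa using (((hasDerivAt_id t).mul_const (inner ℝ (a j) (gen σg μ z))).const_add
        (inner ℝ (a j) (gen σg θ z))).add_const (b j)
    exact (hσ.differentiable _).hasDerivAt.comp t h1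

/-- The Euler–Lagrange equation of `J`: at a stationary point, the gradient of the optimal
discriminator along the generator is orthogonal to every generator in `L²(P_Z)`. -/
lemma IsStationary.integral_inner_discGrad_eq_zero {PX : Measure (E n)} [IsProbabilityMeasure PX]
    {PZ : Measure (E k)} [IsProbabilityMeasure PZ] (hσg : IsGeneratorActivation σg)
    (hσ : IsDiscriminatorActivation σ) {a : Fin N → E n} {b : Fin N → ℝ}
    {θ : SignedMeasure (GenParam k n)} (hθ : IsStationary PX PZ σg σ a b θ)
    (μ : SignedMeasure (GenParam k n)) :
    ∫ z, inner ℝ (discGrad σ a b (featureGap PX PZ σg σ a b θ) (gen σg θ z)) (gen σg μ z) ∂PZ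
      = 0 := by
  set v := featureGap PX PZ σg σ a b θ with hv
  set d : Fin N → ℝ := fun j =>
    ∫ z, deriv σ (inner ℝ (a j) (gen σg θ z) + b j) * inner ℝ (a j) (gen σg μ z) ∂PZ with hd
  have hgap : ∀ j, HasDerivAt (fun t : ℝ => featureGap PX PZ σg σ a b (θ + t • μ) j) (-d j) 0 :=
    fun j => (hasDerivAt_integral_psi_gen PZ hσg hσ a b θ μ j).2.const_sub _
  have hJ : HasDerivAt (fun t : ℝ => J PX PZ σg σ a b (θ + t • μ))
      (1 / 2 * ∑ j, 2 * v j * -d j) 0 := by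
    simp_rw [J_eq PX PZ hσg hσ, EuclideanSpace.norm_sq_eq, Real.norm_eq_abs, sq_abs]
    refine (HasDerivAt.fun_sum fun j _ => ?_).const_mul _
    refine ((hgap j).fun_pow 2).congr_deriv ?_
    simp [hv]
  have h0 : ∑ j, v j * d j = 0 := by
    have h := hJ.unique (hθ μ)
    have h' : ∑ j, 2 * v j * -d j = -2 * ∑ j, v j * d j := by
      rw [Finset.mul_sum]
      exact Finset.sum_congr rfl fun j _ => by ring
    linarith
  rw [← h0]
  simp_rw [hd, ← integral_const_mul]
  rw [← integral_finsetSum _ fun j _ =>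
    (hasDerivAt_integral_psi_gen PZ hσg hσ a b θ μ j).1.const_mul (v j)]
  congr 1 with z
  simp [discGrad, sum_inner, inner_smul_left, mul_assoc]

/-- If all rows of the weights but the `i`-th vanish, the feature function varies only in its `i`-th
coordinate; the other coordinates are `σ_g(0)`. -/
lemma inner_phi_single_row (x : E n) (i : Fin n) (w : Fin k → ℝ) (β : ℝ) (z : E k) :
    inner ℝ x (phi σg z (Pi.single i w, Pi.single i β)) =
      x i * σg (∑ j, w j * z j + β) + σg 0 * (∑ i', x i' - x i) := by
  rw [PiLp.inner_apply, ← Finset.add_sum_erase _ _ (Finset.mem_univ i),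
    ← Finset.add_sum_erase _ (fun i' => x i') (Finset.mem_univ i), add_sub_cancel_left,
    Finset.mul_sum]
  congr 1
  · simp [phi_eq, mul_comm]
  · refine Finset.sum_congr rfl fun i' hi' => ?_
    simp [phi_eq, Pi.single_eq_of_ne (Finset.ne_of_mem_erase hi')]

lemma IsLatentLaw.eq_zero_of_ae_eq_zero {PZ : Measure (E k)} (hPZ : IsLatentLaw PZ) {h : E k → ℝ}
    (hc : Continuous h) (h0 : h =ᵐ[PZ] 0) : h = 0 := by
  obtain ⟨q, ⟨K, hK⟩, hpos, rfl⟩ := hPZ.density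
  refine (hc.ae_eq_iff_eq volume continuous_zero).1 ?_
  filter_upwards [(ae_withDensity_iff hK.continuous.measurable.ennreal_ofReal).1 h0] with z hz
  exact hz (ENNReal.ofReal_pos.2 (hpos z)).ne'

/-- At a stationary point, the gradient of the optimal discriminator vanishes on the range of the
generator. -/
lemma IsStationary.discGrad_eq_zero {PX : Measure (E n)} [IsProbabilityMeasure PX]
    {PZ : Measure (E k)} (hPZ : IsLatentLaw PZ) (hσg : IsGeneratorActivation σg)
    (hσ : IsDiscriminatorActivation σ) {a : Fin N → E n} {b : Fin N → ℝ}
    {θ : SignedMeasure (GenParam k n)} (hθ : IsStationary PX PZ σg σ a b θ) (z : E k) :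
    discGrad σ a b (featureGap PX PZ σg σ a b θ) (gen σg θ z) = 0 := by
  have := hPZ.isProbability
  set D : E k → E n := fun z => discGrad σ a b (featureGap PX PZ σg σ a b θ) (gen σg θ z) with hD
  have hDc : Continuous D := (continuous_discGrad hσ _ _ _).comp (continuous_gen hσg θ)
  obtain ⟨C, hC⟩ := exists_norm_discGrad_le hσ a b (featureGap PX PZ σg σ a b θ)
  have hDi : ∀ i, Integrable (fun z => D z i) PZ := fun i =>
    Integrable.of_bound (Continuous.aestronglyMeasurable (by fun_prop)) C
      (ae_of_all _ fun z => (PiLp.norm_apply_le (D z) i).trans (hC _))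
  suffices h : ∀ i, (fun z => D z i) = 0 from PiLp.ext fun i => congrFun (h i) z
  intro i
  refine hPZ.eq_zero_of_ae_eq_zero (by fun_prop) ?_
  refine ae_eq_zero_of_setIntegral_halfSpace_eq_zero (hDi i)
    (setIntegral_halfSpace_eq_zero hσg (hDi i)
      (c := -∫ z, σg 0 * (∑ i', D z i' - D z i) ∂PZ) fun L β => ?_)
  have hL : ∀ z : E k, L z = ∑ j, L (EuclideanSpace.single j 1) * z j := fun z => by
    conv_lhs => rw [← (EuclideanSpace.basisFun (Fin k) ℝ).sum_repr z]
    simp [map_sum, mul_comm]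
  -- Stationarity in the direction of the Dirac mass at the parameter whose `i`-th row is `(L, β)` and
  -- whose other rows vanish; those rows contribute the constant `c`.
  have h0 := hθ.integral_inner_discGrad_eq_zero hσg hσ
    (VectorMeasure.dirac (Pi.single i fun j => L (EuclideanSpace.single j 1), Pi.single i β) 1)
  simp_rw [gen_dirac, inner_phi_single_row, ← hL] at h0
  rw [integral_add] at h0
  · exact eq_neg_of_add_eq_zero_left h0
  · obtain ⟨M, hM⟩ := hσg.bounded
    have := hσg.continuous
    exact (hDi i).mul_bdd (c := M) (Continuous.aestronglyMeasurable (by fun_prop))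
      (ae_of_all _ fun z => hM _)
  · exact ((integrable_finsetSum _ fun i' _ => hDi i').sub (hDi i)).const_mul _

/-- The deterministic form of the result, for an arbitrary value of the discriminator weights. -/
theorem IsStationary.J_eq_zero {PX : Measure (E n)} [IsProbabilityMeasure PX]
    {PZ : Measure (E k)} (hPZ : IsLatentLaw PZ) (hσg : IsGeneratorActivation σg)
    (hσ : IsDiscriminatorActivation σ) {a : Fin N → E n} {b : Fin N → ℝ}
    {θ : SignedMeasure (GenParam k n)} (hθ : IsStationary PX PZ σg σ a b θ)
    {c : E n} {ε : ℝ} (hε : 0 < ε) (hball : Metric.ball c ε ⊆ Set.range (gen σg θ)) :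
    J PX PZ σg σ a b θ = 0 := by
  have := hPZ.isProbability
  have hconst := disc_eq_const_of_fderiv_eq_zero_on_ball hσ a b (featureGap PX PZ σg σ a b θ) hε
    fun x hx => by
      obtain ⟨z, rfl⟩ := hball hx
      rw [(hasFDerivAt_disc hσ a b _ _).fderiv, hθ.discGrad_eq_zero hPZ hσg hσ z, map_zero]
  have hgap := integral_disc_sub_integral_disc_gen PX PZ hσg hσ a b θ
    (featureGap PX PZ σg σ a b θ)
  simp_rw [hconst, integral_const, probReal_univ, sub_self, real_inner_self_eq_norm_sq] at hgap
  rw [J_eq PX PZ hσg hσ, ← hgap, mul_zero]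

end Objective

end RandomFeatureGAN

theorem theorem2 {k n N : ℕ}
    (PX : Measure (RandomFeatureGAN.E n)) [IsProbabilityMeasure PX]
    (PZ : Measure (RandomFeatureGAN.E k)) (hPZ : RandomFeatureGAN.IsLatentLaw PZ)
    (σg : ℝ → ℝ) (hσg : RandomFeatureGAN.IsGeneratorActivation σg)
    (σ : ℝ → ℝ) (hσ : σ = Real.sigmoid ∨ σ = Real.tanh)
    {Ω : Type*} [MeasurableSpace Ω] (P : Measure Ω) [IsProbabilityMeasure P]
    (a : Fin N → Ω → RandomFeatureGAN.E n) (b : Fin N → Ω → ℝ)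
    (hab : RandomFeatureGAN.IsRandomWeights P a b) :
    ∀ᵐ ω ∂P, ∀ θ : SignedMeasure (RandomFeatureGAN.GenParam k n),
      RandomFeatureGAN.IsStationary PX PZ σg σ (fun j => a j ω) (fun j => b j ω) θ →
      (∃ (c : RandomFeatureGAN.E n) (ε : ℝ), 0 < ε ∧
        Metric.ball c ε ⊆ Set.range (RandomFeatureGAN.gen σg θ)) →
      RandomFeatureGAN.J PX PZ σg σ (fun j => a j ω) (fun j => b j ω) θ = 0 := by

  have hσ' : RandomFeatureGAN.IsDiscriminatorActivation σ := by
    rcases hσ with rfl | rfl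
    · exact RandomFeatureGAN.isDiscriminatorActivation_sigmoid
    · exact RandomFeatureGAN.isDiscriminatorActivation_tanh
  exact ae_of_all _ fun ω θ hθ ⟨c, ε, hε, hball⟩ => hθ.J_eq_zero hPZ hσg hσ' hε hball
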